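/- Let $R$ be an associative ring with identity, not necessarily commutative, and let $\alpha : R \to R$ be a (unital) ring endomorphism. For a ring $S$, let $U(S)$ be its group of units and $\Delta(S) = \{ s \in S : s + U(S) \subseteq U(S) \}$; $S$ is called $2$-$\Delta U$ if the square of each unit of $S$ is the sum of an idempotent of $S$ and an element of $\Delta(S)$. Suppose that $R$ is $2$-primal, i.e. the intersection of all prime (two-sided) ideals of $R$ is exactly the set of all nilpotent elements of $R$, and that $R$ is $\alpha$-compatible, i.e. for all $a, b \in R$, $ab = 0$ if and only if $a\,\alpha(b) = 0$. Let $R[x;\alpha]$ be the skew polynomial ring over $R$, whose elements are the polynomials $\sum_i a_i x^i$ with $a_i \in R$ and whose multiplication is determined by $xr = \alpha(r)x$ for all $r \in R$. Then $R[x;\alpha]$ is a $2$-$\Delta U$ ring if and only if $R$ is a $2$-$\Delta U$ ring. -/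

import Mathlib

namespace TwoDeltaU

/-- The set `Δ(R) = {r ∈ R | r + U(R) ⊆ U(R)}`. -/
def delta (R : Type*) [Ring R] : Set R :=
  {r | ∀ u : R, IsUnit u → IsUnit (r + u)}

/-- `R` is a 2-ΔU ring: the square of each unit is the sum of an idempotent and an
element of `Δ(R)`. -/
def IsTwoDeltaU (R : Type*) [Ring R] : Prop :=
  ∀ u : R, IsUnit u → ∃ e r : R, IsIdempotentElem e ∧ r ∈ delta R ∧ u ^ 2 = e + r

/-- Equivalently, the square of each unit lies in `1 + Δ(R)`. -/
theorem isTwoDeltaU_iff (R : Type*) [Ring R] :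
    IsTwoDeltaU R ↔ ∀ u : R, IsUnit u → u ^ 2 - 1 ∈ delta R := by
  constructor
  · intro h u hu
    obtain ⟨e, r, he, hr, h2⟩ := h u hu
    have h1 : IsUnit e := by
      have h3 : IsUnit (r + -(u ^ 2)) := hr _ (hu.pow 2).neg
      rw [h2] at h3
      have h4 : r + -(e + r) = -e := by abel
      rw [h4] at h3
      simpa using h3.neg
    have h5 : e = 1 := h1.mul_left_cancel (by rw [mul_one]; exact he)
    rw [h2, h5]
    simpa using hr
  · intro h u hu
    exact ⟨1, u ^ 2 - 1, IsIdempotentElem.one, h u hu, by abel⟩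

/-- A prime ideal of a (not necessarily commutative) ring: a proper two-sided ideal `P` such
that, for all two-sided ideals `I`, `J`, if `IJ ⊆ P` then `I ⊆ P` or `J ⊆ P`. (As `P` is closed
under addition, `IJ ⊆ P` says that all products `ab` with `a ∈ I`, `b ∈ J` are in `P`.) -/
structure IsPrimeIdeal {R : Type*} [Ring R] (P : TwoSidedIdeal R) : Prop where
  ne_top : P ≠ ⊤
  le_or_le : ∀ I J : TwoSidedIdeal R, (∀ a ∈ I, ∀ b ∈ J, a * b ∈ P) → I ≤ P ∨ J ≤ P

/-- The usual elementwise description of prime ideals: `aRb ⊆ P` implies `a ∈ P` or `b ∈ P`. -/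
theorem isPrimeIdeal_iff {R : Type*} [Ring R] (P : TwoSidedIdeal R) :
    IsPrimeIdeal P ↔ P ≠ ⊤ ∧ ∀ a b : R, (∀ r : R, a * r * b ∈ P) → a ∈ P ∨ b ∈ P := by
  constructor
  · refine fun h => ⟨h.ne_top, fun a b hab => ?_⟩
    have key : ∀ x ∈ TwoSidedIdeal.span {a}, ∀ r : R, x * r * b ∈ P := by
      intro x hx
      induction hx using TwoSidedIdeal.span_induction with
      | mem x hx => obtain rfl := hx; exact hab
      | zero => intro r; simpa using P.zero_mem
      | add x y _ _ hx hy => intro r; rw [add_mul, add_mul]; exact P.add_mem (hx r) (hy r)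
      | neg x _ hx => intro r; rw [neg_mul, neg_mul]; exact P.neg_mem (hx r)
      | left_absorb s x _ hx =>
        intro r; rw [mul_assoc, mul_assoc, ← mul_assoc x]; exact P.mul_mem_left _ _ (hx r)
      | right_absorb s x _ hx => intro r; rw [mul_assoc x]; exact hx _
    have key2 : ∀ y ∈ TwoSidedIdeal.span {b}, ∀ x ∈ TwoSidedIdeal.span {a},
        ∀ r : R, x * r * y ∈ P := by
      intro y hy
      induction hy using TwoSidedIdeal.span_induction with
      | mem y hy => obtain rfl := hy; exact key
      | zero => intro x _ r; simpa using P.zero_mem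
      | add y z _ _ hy hz =>
        intro x hx r; rw [mul_add]; exact P.add_mem (hy x hx r) (hz x hx r)
      | neg y _ hy => intro x hx r; rw [mul_neg]; exact P.neg_mem (hy x hx r)
      | left_absorb s y _ hy =>
        intro x hx r; rw [← mul_assoc, mul_assoc x]; exact hy x hx _
      | right_absorb s y _ hy =>
        intro x hx r; rw [← mul_assoc]; exact P.mul_mem_right _ _ (hy x hx r)
    rcases h.le_or_le (TwoSidedIdeal.span {a}) (TwoSidedIdeal.span {b})
      (fun x hx y hy => by simpa using key2 y hy x hx 1) with h1 | h1
    · exact Or.inl (h1 (TwoSidedIdeal.subset_span rfl))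
    · exact Or.inr (h1 (TwoSidedIdeal.subset_span rfl))
  · rintro ⟨h0, h⟩
    refine ⟨h0, fun I J hIJ => ?_⟩
    by_contra! hc
    obtain ⟨a, ha, haP⟩ := Set.not_subset.mp hc.1
    obtain ⟨b, hb, hbP⟩ := Set.not_subset.mp hc.2
    rcases h a b (fun r => hIJ _ (I.mul_mem_right _ _ ha) _ hb) with h1 | h1
    · exact haP h1
    · exact hbP h1

/-- The prime radical (lower nil-radical) of `R`: the intersection of all prime ideals. -/
def primeRadical (R : Type*) [Ring R] : Set R :=
  {r | ∀ P : TwoSidedIdeal R, IsPrimeIdeal P → r ∈ P}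

/-- `R` is 2-primal: its prime radical is the set of all nilpotent elements. -/
def IsTwoPrimal (R : Type*) [Ring R] : Prop :=
  primeRadical R = {r : R | IsNilpotent r}

/-- `R` is `α`-compatible: `ab = 0` if and only if `aα(b) = 0`. -/
def IsCompatible {R : Type*} [Ring R] (α : R →+* R) : Prop :=
  ∀ a b : R, a * b = 0 ↔ a * α b = 0

/-- The action of the monoid `ℕ` on `R` in which `n` acts as the iterate `α^n`. -/
abbrev iterateAction {R : Type*} [Ring R] (α : R →+* R) :
    MulSemiringAction (Multiplicative ℕ) R where
  smul n r := α^[n.toAdd] r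
  one_smul _ := rfl
  mul_smul m n r := Function.iterate_add_apply α m.toAdd n.toAdd r
  smul_zero n := iterate_map_zero α n.toAdd
  smul_add n := iterate_map_add α n.toAdd
  smul_one n := iterate_map_one α n.toAdd
  smul_mul n := iterate_map_mul α n.toAdd

/-- The skew polynomial ring `R[x; α]`: Mathlib's skew polynomials `∑ aᵢ xⁱ`, where the
twisting endomorphism is `α`, so that `x r = α(r) x`. -/
def SkewPoly {R : Type*} [Ring R] (_α : R →+* R) : Type _ := SkewPolynomial R

noncomputable instance {R : Type*} [Ring R] (α : R →+* R) : Ring (SkewPoly α) :=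
  letI := iterateAction α
  (inferInstance : Ring (SkewPolynomial R))

/-- The monomial `r xⁿ` of `R[x; α]`. -/
noncomputable def SkewPoly.monomial {R : Type*} [Ring R] (α : R →+* R) (n : ℕ) (r : R) :
    SkewPoly α :=
  SkewPolynomial.monomial n r

/-- The multiplication rule `(r xⁿ)(s xᵐ) = r αⁿ(s) xⁿ⁺ᵐ`. -/
theorem SkewPoly.monomial_mul_monomial {R : Type*} [Ring R] (α : R →+* R) (n m : ℕ) (r s : R) :
    SkewPoly.monomial α n r * SkewPoly.monomial α m s =
      SkewPoly.monomial α (n + m) (r * α^[n] s) := by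
  letI := iterateAction α
  exact SkewPolynomial.monomial_mul_monomial n m r s

end TwoDeltaU

/-! Let `N` be the prime radical, here also the set of nilpotents. The units of `R[x; α]` are
exactly the polynomials with unit constant coefficient and all other coefficients in `N`. Since `N`
is an ideal, for units `f`, `g` the higher coefficients of `f² - 1 + g` lie in `N`, so whether it is
a unit is decided by constant coefficients, that is, in `R`; constant polynomials give the converse.
`isUnit_of_coeff` rests on local nilpotence of `N`: compatibility lets the twists be ignored, so a
polynomial over `N` is nilpotent. `coeff_mem_of_isUnit` compares coefficients in `f * g = 1`, as
over a reduced ring, working modulo `N`. -/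

namespace TwoDeltaU

/-! ### Local nilpotence of the prime radical -/

section LocalNilpotence

open scoped Pointwise

variable {R : Type*} [Ring R]

/-- The union of a nonempty chain of two-sided ideals. -/
def chainUnion (c : Set (TwoSidedIdeal R)) (hc : IsChain (· ≤ ·) c) (hne : c.Nonempty) :
    TwoSidedIdeal R :=
  .mk' {x | ∃ I ∈ c, x ∈ I}
    (hne.elim fun I hI => ⟨I, hI, I.zero_mem⟩)
    (by
      rintro x y ⟨I, hI, hx⟩ ⟨J, hJ, hy⟩
      rcases hc.total hI hJ with h | h
      · exact ⟨J, hJ, J.add_mem (h hx) hy⟩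
      · exact ⟨I, hI, I.add_mem hx (h hy)⟩)
    (by rintro x ⟨I, hI, hx⟩; exact ⟨I, hI, I.neg_mem hx⟩)
    (by rintro x y ⟨I, hI, hy⟩; exact ⟨I, hI, I.mul_mem_left _ _ hy⟩)
    (by rintro x y ⟨I, hI, hx⟩; exact ⟨I, hI, I.mul_mem_right _ _ hx⟩)

theorem mem_chainUnion {c : Set (TwoSidedIdeal R)} {hc : IsChain (· ≤ ·) c} {hne : c.Nonempty}
    {x : R} : x ∈ chainUnion c hc hne ↔ ∃ I ∈ c, x ∈ I :=
  TwoSidedIdeal.mem_mk' ..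

/-- A finite set contained in a nonempty chain's union is contained in a member of the chain. -/
theorem exists_mem_subset_of_finite {c : Set (TwoSidedIdeal R)} (hc : IsChain (· ≤ ·) c)
    (hne : c.Nonempty) {S : Set R} (hS : S.Finite) (h : ∀ x ∈ S, ∃ I ∈ c, x ∈ I) :
    ∃ I ∈ c, ∀ x ∈ S, x ∈ I := by
  induction S, hS using Set.Finite.induction_on with
  | empty => exact hne.elim fun I hI => ⟨I, hI, by simp⟩
  | @insert a S _ _ ih =>
    obtain ⟨I, hI, hIS⟩ := ih fun x hx => h x (Set.mem_insert_of_mem _ hx)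
    obtain ⟨J, hJ, ha⟩ := h a (Set.mem_insert _ _)
    rcases hc.total hI hJ with h' | h'
    · exact ⟨J, hJ, Set.forall_mem_insert.2 ⟨ha, fun x hx => h' (hIS x hx)⟩⟩
    · exact ⟨I, hI, Set.forall_mem_insert.2 ⟨h' ha, hIS⟩⟩

theorem finite_set_pow {S : Set R} (hS : S.Finite) (n : ℕ) : (S ^ n).Finite := by
  induction n with
  | zero => simp
  | succ n ih => rw [pow_succ]; exact ih.mul hS

/-- The prime radical is locally nilpotent. -/
theorem exists_pow_eq_zero_of_subset_primeRadical {F : Set R} (hF : F.Finite)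
    (h : F ⊆ primeRadical R) : ∃ m : ℕ, ∀ w ∈ F ^ m, w = 0 := by
  by_contra hbad
  -- Ideals containing no power of `F`; a maximal one will be a prime that does not contain `F`.
  let T : Set (TwoSidedIdeal R) := {I | ∀ m : ℕ, ∃ w ∈ F ^ m, w ∉ I}
  have hbot : (⊥ : TwoSidedIdeal R) ∈ T := by
    intro m
    by_contra! hm
    exact hbad ⟨m, fun w hw => (TwoSidedIdeal.mem_bot R).1 (hm w hw)⟩
  obtain ⟨P, -, hP⟩ := zorn_le_nonempty₀ T (fun c hcT hc I hI => by
    refine ⟨chainUnion c hc ⟨I, hI⟩, fun m => ?_, fun J hJ x hx => mem_chainUnion.2 ⟨J, hJ, hx⟩⟩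
    by_contra! hm
    -- `F ^ m` is finite, so one member of the chain already contains it.
    obtain ⟨J, hJ, hJm⟩ := exists_mem_subset_of_finite hc ⟨I, hI⟩ (finite_set_pow hF m)
      fun x hx => mem_chainUnion.1 (hm x hx)
    obtain ⟨w, hw, hwJ⟩ := hcT hJ m
    exact hwJ (hJm w hw)) ⊥ hbot
  have hgood : ∀ I : TwoSidedIdeal R, ¬ I ≤ P → ∃ m : ℕ, ∀ w ∈ F ^ m, w ∈ I ⊔ P := by
    intro I hI
    by_contra! hc
    exact hI (le_sup_left.trans (hP.le_of_ge (y := I ⊔ P) hc le_sup_right))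
  have hprime : IsPrimeIdeal P := by
    refine ⟨?_, fun I J hIJ => ?_⟩
    · rintro rfl
      obtain ⟨w, -, hw⟩ := hP.prop 0
      exact hw (TwoSidedIdeal.mem_top R)
    · by_contra! hc
      obtain ⟨m, hm⟩ := hgood I hc.1
      obtain ⟨n, hn⟩ := hgood J hc.2
      obtain ⟨w, hw, hwP⟩ := hP.prop (m + n)
      rw [pow_add] at hw
      obtain ⟨a, ha, b, hb, rfl⟩ := hw
      obtain ⟨i, hi, p, hp, rfl⟩ := TwoSidedIdeal.mem_sup.1 (hm a ha)
      obtain ⟨j, hj, q, hq, rfl⟩ := TwoSidedIdeal.mem_sup.1 (hn b hb)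
      refine hwP ?_
      change (i + p) * (j + q) ∈ P
      rw [mul_add, add_mul]
      exact P.add_mem (P.add_mem (hIJ i hi j hj) (P.mul_mem_right _ _ hp)) (P.mul_mem_left _ _ hq)
  obtain ⟨w, hw, hwP⟩ := hP.prop 1
  rw [pow_one] at hw
  exact hwP (h hw P hprime)

end LocalNilpotence

/-! ### Calculus modulo the nilpotents -/

section Nilpotents

variable {R : Type*} [Ring R]

/-- The prime radical as a two-sided ideal. -/
def primeRadicalIdeal (R : Type*) [Ring R] : TwoSidedIdeal R :=
  sInf {P | IsPrimeIdeal P}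

theorem mem_primeRadicalIdeal {a : R} : a ∈ primeRadicalIdeal R ↔ a ∈ primeRadical R :=
  TwoSidedIdeal.mem_sInf R

theorem IsTwoPrimal.mem_primeRadicalIdeal_iff (h : IsTwoPrimal R) {a : R} :
    a ∈ primeRadicalIdeal R ↔ IsNilpotent a := by
  rw [mem_primeRadicalIdeal, h]; rfl

theorem isNilpotent_mul_swap {a b : R} (h : IsNilpotent (a * b)) : IsNilpotent (b * a) := by
  obtain ⟨n, hn⟩ := h
  refine ⟨n + 1, ?_⟩
  have key : ∀ k : ℕ, (b * a) ^ (k + 1) = b * (a * b) ^ k * a := by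
    intro k
    induction k with
    | zero => simp
    | succ k ih => rw [pow_succ, ih, pow_succ]; simp only [mul_assoc]
  rw [key, hn, mul_zero, zero_mul]

theorem IsTwoPrimal.mul_swap_mem (h : IsTwoPrimal R) {a b : R}
    (hab : a * b ∈ primeRadicalIdeal R) : b * a ∈ primeRadicalIdeal R := by
  rw [h.mem_primeRadicalIdeal_iff] at *
  exact isNilpotent_mul_swap hab

theorem IsTwoPrimal.mem_of_mul_self_mem (h : IsTwoPrimal R) {a : R}
    (ha : a * a ∈ primeRadicalIdeal R) : a ∈ primeRadicalIdeal R := by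
  rw [h.mem_primeRadicalIdeal_iff] at *
  rw [← pow_two] at ha
  exact ha.of_pow

/-- In a 2-primal ring, factors can be inserted into a nilpotent product. -/
theorem IsTwoPrimal.mul_mul_mem (h : IsTwoPrimal R) {a b : R} (r : R)
    (hab : a * b ∈ primeRadicalIdeal R) : a * r * b ∈ primeRadicalIdeal R := by
  refine h.mem_of_mul_self_mem ?_
  -- `(arb)² = ar(ba)rb`.
  have := TwoSidedIdeal.mul_mem_left _ (a * r) _
    (TwoSidedIdeal.mul_mem_right _ _ (r * b) (h.mul_swap_mem hab))
  simpa only [mul_assoc] using this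

theorem IsTwoPrimal.mem_of_mul_mul_mem (h : IsTwoPrimal R) {a b : R}
    (hab : a * (a * b) ∈ primeRadicalIdeal R) : a * b ∈ primeRadicalIdeal R := by
  refine h.mem_of_mul_self_mem ?_
  have := TwoSidedIdeal.mul_mem_right _ _ b (h.mul_swap_mem hab)
  simpa only [mul_assoc] using this

variable {α : R →+* R}

theorem IsCompatible.mul_iterate (hα : IsCompatible α) (n : ℕ) (a b : R) :
    a * b = 0 ↔ a * α^[n] b = 0 := by
  induction n with
  | zero => rfl
  | succ n ih => rw [ih, Function.iterate_succ_apply', ← hα]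

/-- Factors are twisted one at a time, with `c` absorbing those on the left: apply `α` to the whole
tail starting at `b`, then remove it from what follows `b`. -/
theorem IsCompatible.mul_pow_eq_zero_iff (hα : IsCompatible α) (a b : R) (n : ℕ) (c : R) :
    c * (a * b) ^ n = 0 ↔ c * (a * α b) ^ n = 0 := by
  induction n generalizing c with
  | zero => simp
  | succ n ih =>
    rw [pow_succ', pow_succ', ← mul_assoc, ih, ← mul_assoc, ← mul_assoc, ← mul_assoc,
      mul_assoc (c * a) b, hα, map_mul, ← mul_assoc, ← hα]

theorem IsCompatible.isNilpotent_mul_iff (hα : IsCompatible α) (a b : R) :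
    IsNilpotent (a * b) ↔ IsNilpotent (a * α b) :=
  exists_congr fun n => by simpa using hα.mul_pow_eq_zero_iff a b n 1

theorem IsTwoPrimal.mul_iterate_mem_iff (h : IsTwoPrimal R) (hα : IsCompatible α) (n : ℕ)
    (a b : R) : a * b ∈ primeRadicalIdeal R ↔ a * α^[n] b ∈ primeRadicalIdeal R := by
  simp only [h.mem_primeRadicalIdeal_iff]
  induction n with
  | zero => rfl
  | succ n ih => rw [ih, Function.iterate_succ_apply', ← hα.isNilpotent_mul_iff]

end Nilpotents

/-! ### Coefficients of skew polynomials -/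

namespace SkewPoly

variable {R : Type*} [Ring R] {α : R →+* R}

/-- The coefficient of `xⁿ`. -/
def coeff (n : ℕ) : SkewPoly α →+ R where
  toFun f := SkewPolynomial.coeff (R := R) f n
  map_zero' := rfl
  map_add' f g := SkewPolynomial.coeff_add (R := R) f g n

theorem coeff_monomial (n m : ℕ) (a : R) :
    coeff m (monomial α n a) = if n = m then a else 0 :=
  SkewPolynomial.coeff_monomial

theorem ext_coeff {f g : SkewPoly α} (h : ∀ n, coeff n f = coeff n g) : f = g :=
  SkewPolynomial.ext (R := R) h

theorem one_def : (1 : SkewPoly α) = monomial α 0 1 := rfl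

theorem coeff_one (n : ℕ) : coeff n (1 : SkewPoly α) = if n = 0 then 1 else 0 := by
  rw [one_def, coeff_monomial]
  simp only [eq_comm]

theorem induction_add {p : SkewPoly α → Prop} (f : SkewPoly α) (h0 : p 0)
    (hadd : ∀ f g, p f → p g → p (f + g)) (hmon : ∀ n a, p (monomial α n a)) : p f := by
  refine SkewPolynomial.induction (R := R) f h0 fun n a g _ _ hg => ?_
  exact hadd _ _ (hmon n a) hg

theorem finite_range_coeff (f : SkewPoly α) : (Set.range fun n => coeff n f).Finite := by
  have h : (Set.range fun n => coeff n f) ⊆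
      insert 0 ((fun n => coeff n f) '' (SkewPolynomial.support (R := R) f : Set ℕ)) := by
    rintro _ ⟨n, rfl⟩
    by_cases hn : coeff n f = 0
    · exact Or.inl hn
    · exact Or.inr ⟨n, SkewPolynomial.mem_support_iff.2 hn, rfl⟩
  exact (((Finset.finite_toSet _).image _).insert 0).subset h

theorem exists_forall_coeff_eq_zero (f : SkewPoly α) : ∃ d, ∀ n, d ≤ n → coeff n f = 0 := by
  refine ⟨(SkewPolynomial.support (R := R) f).sup id + 1, fun n hn => ?_⟩
  by_contra h
  have := Finset.le_sup (f := id) (SkewPolynomial.mem_support_iff.2 h)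
  simp only [id] at this
  omega

theorem coeff_mul (f g : SkewPoly α) (k : ℕ) :
    coeff k (f * g) =
      ∑ p ∈ Finset.HasAntidiagonal.antidiagonal k, coeff p.1 f * α^[p.1] (coeff p.2 g) := by
  induction f using induction_add with
  | h0 => simp
  | hadd f₁ f₂ h₁ h₂ => simp only [add_mul, map_add, h₁, h₂, Finset.sum_add_distrib]
  | hmon n a =>
    induction g using induction_add with
    | h0 => simp [iterate_map_zero]
    | hadd g₁ g₂ h₁ h₂ =>
      simp only [mul_add, map_add, h₁, h₂, iterate_map_add, Finset.sum_add_distrib]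
    | hmon m b =>
      rw [monomial_mul_monomial, coeff_monomial]
      have h : ∀ p : ℕ × ℕ, coeff p.1 (monomial α n a) * α^[p.1] (coeff p.2 (monomial α m b)) =
          if p = (n, m) then a * α^[n] b else 0 := by
        rintro ⟨i, j⟩
        simp only [coeff_monomial, Prod.mk.injEq]
        by_cases hi : n = i
        · subst hi
          by_cases hj : m = j
          · simp [hj]
          · simp [hj, Ne.symm hj, iterate_map_zero]
        · simp [hi, Ne.symm hi]
      simp only [h, Finset.sum_ite_eq', Finset.HasAntidiagonal.mem_antidiagonal]

theorem coeff_zero_mul (f g : SkewPoly α) : coeff 0 (f * g) = coeff 0 f * coeff 0 g := by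
  simp [coeff_mul]

theorem isUnit_coeff_zero {f : SkewPoly α} (hf : IsUnit f) : IsUnit (coeff 0 f) := by
  obtain ⟨u, rfl⟩ := hf
  refine ⟨⟨coeff 0 u.1, coeff 0 u.2, ?_, ?_⟩, rfl⟩
  · rw [← coeff_zero_mul, u.3]; simp [coeff_one]
  · rw [← coeff_zero_mul, u.4]; simp [coeff_one]

/-- The embedding of `R` as constants of `R[x; α]`. -/
noncomputable def C (α : R →+* R) : R →+* SkewPoly α where
  toFun := monomial α 0
  map_one' := rfl
  map_mul' a b := by rw [monomial_mul_monomial]; rfl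
  map_zero' := ext_coeff fun n => by simp [coeff_monomial]
  map_add' a b := ext_coeff fun n => by
    simp only [map_add, coeff_monomial]
    split_ifs <;> simp

theorem coeff_C (n : ℕ) (a : R) : coeff n (C α a) = if n = 0 then a else 0 :=
  (coeff_monomial 0 n a).trans (by simp only [eq_comm])

theorem coeff_zero_C (a : R) : coeff 0 (C α a) = a := by simp [coeff_C]

theorem coeff_C_mul (n : ℕ) (a : R) (f : SkewPoly α) : coeff n (C α a * f) = a * coeff n f := by
  rw [coeff_mul, Finset.sum_eq_single (0, n)]
  · simp [coeff_C]
  · rintro ⟨i, j⟩ hij hne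
    rw [Finset.HasAntidiagonal.mem_antidiagonal] at hij
    have : i ≠ 0 := by
      rintro rfl
      exact hne (by simpa using hij)
    simp [coeff_C, this]
  · simp

/-! ### Nilpotent and invertible skew polynomials -/

open scoped Pointwise in
theorem mul_coeff_pow_eq_zero (hα : IsCompatible α) (f : SkewPoly α) (m : ℕ) (c : R)
    (h : ∀ w ∈ (Set.range fun n => coeff n f) ^ m, c * w = 0) (n : ℕ) :
    c * coeff n (f ^ m) = 0 := by
  induction m generalizing c n with
  | zero =>
    have hc : c = 0 := by simpa using h 1 (by simp)
    rw [hc, zero_mul]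
  | succ m ih =>
    rw [pow_succ', coeff_mul, Finset.mul_sum]
    refine Finset.sum_eq_zero fun p _ => ?_
    -- With the new coefficient moved into `c`, compatibility removes the twist on the coefficient
    -- of `f ^ m`.
    rw [← mul_assoc, ← hα.mul_iterate]
    refine ih _ (fun w hw => ?_) _
    rw [mul_assoc]
    refine h _ ?_
    rw [pow_succ']
    exact Set.mul_mem_mul ⟨_, rfl⟩ hw

theorem isNilpotent_of_coeff_mem (hα : IsCompatible α) {f : SkewPoly α}
    (hf : ∀ n, coeff n f ∈ primeRadicalIdeal R) : IsNilpotent f := by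
  obtain ⟨m, hm⟩ := exists_pow_eq_zero_of_subset_primeRadical (finite_range_coeff f)
    (Set.range_subset_iff.2 fun n => mem_primeRadicalIdeal.1 (hf n))
  refine ⟨m, ext_coeff fun n => ?_⟩
  have := mul_coeff_pow_eq_zero hα f m 1 (fun w hw => by rw [hm w hw, mul_zero]) n
  rwa [one_mul] at this

/-- A skew polynomial is a unit if its constant coefficient is a unit and its other coefficients
lie in the prime radical. -/
theorem isUnit_of_coeff (hα : IsCompatible α) {f : SkewPoly α} (h0 : IsUnit (coeff 0 f))
    (h : ∀ n, n ≠ 0 → coeff n f ∈ primeRadicalIdeal R) : IsUnit f := by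
  obtain ⟨u, hu⟩ := h0
  have hnil : IsNilpotent (C α ↑u⁻¹ * f - 1) := by
    refine isNilpotent_of_coeff_mem hα fun n => ?_
    rw [map_sub, coeff_C_mul, coeff_one]
    by_cases hn : n = 0
    · subst hn
      simp [← hu]
    · rw [if_neg hn, sub_zero]
      exact TwoSidedIdeal.mul_mem_left _ _ _ (h n hn)
  have hf : f = C α u * (1 + (C α ↑u⁻¹ * f - 1)) := by
    rw [add_sub_cancel, ← mul_assoc, ← map_mul, u.mul_inv, map_one, one_mul]
  rw [hf]
  exact (u.isUnit.map (C α)).mul hnil.isUnit_one_add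

/-- The coefficients of positive degree of a unit lie in the prime radical. -/
theorem coeff_mem_of_isUnit (hR : IsTwoPrimal R) (hα : IsCompatible α) {f : SkewPoly α}
    (hf : IsUnit f) (n : ℕ) (hn : n ≠ 0) : coeff n f ∈ primeRadicalIdeal R := by
  obtain ⟨g, hfg, hgf⟩ := isUnit_iff_exists.1 hf
  have hg0 : IsUnit (coeff 0 g) := isUnit_coeff_zero (isUnit_iff_exists.2 ⟨f, hgf, hfg⟩)
  obtain ⟨d, hd⟩ := exists_forall_coeff_eq_zero f
  obtain ⟨e, he⟩ := exists_forall_coeff_eq_zero g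
  -- Descending induction on `n` from the degree bound `d`; `key` below descends likewise on `j`
  -- from `e`.
  suffices H : ∀ k n, d ≤ n + k → n ≠ 0 → coeff n f ∈ primeRadicalIdeal R from
    H d n (by omega) hn
  intro k
  induction k with
  | zero => intro n hdn _; rw [hd n hdn]; exact TwoSidedIdeal.zero_mem _
  | succ k ihk =>
    intro n hdn hn
    have key : ∀ l j, e ≤ j + l → coeff n f * coeff j g ∈ primeRadicalIdeal R := by
      intro l
      induction l with
      | zero => intro j hj; rw [he j hj, mul_zero]; exact TwoSidedIdeal.zero_mem _
      | succ l ihl =>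
        intro j hj
        rw [hR.mul_iterate_mem_iff hα n]
        -- An extra left factor `coeff n f` makes the inner hypothesis usable on the terms with `i <
        -- n`, where `j' > j`; terms with `i > n` fall to the outer one.
        refine hR.mem_of_mul_mul_mem ?_
        have hsum := coeff_mul f g (n + j)
        rw [hfg, coeff_one, if_neg (by omega),
          ← Finset.add_sum_erase _ _ (Finset.HasAntidiagonal.mem_antidiagonal.2 rfl : (n, j) ∈ _)] at hsum
        rw [eq_neg_of_add_eq_zero_left hsum.symm, mul_neg, Finset.mul_sum]
        refine TwoSidedIdeal.neg_mem _ (sum_mem fun p hp => ?_)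
        obtain ⟨i, j'⟩ := p
        rw [Finset.mem_erase, Finset.HasAntidiagonal.mem_antidiagonal] at hp
        obtain ⟨hne, hij⟩ := hp
        simp only at hij ⊢
        rcases lt_trichotomy i n with hi | rfl | hi
        · rw [← mul_assoc]
          refine hR.mul_mul_mem _ ?_
          rw [← hR.mul_iterate_mem_iff hα]
          exact ihl j' (by omega)
        · exact absurd (by rw [Nat.add_left_cancel hij]) hne
        · exact TwoSidedIdeal.mul_mem_left _ _ _
            (TwoSidedIdeal.mul_mem_right _ _ _ (ihk i (by omega) (by omega)))
    -- At `j = 0` the other factor is a unit and cancels.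
    have h := key e 0 (by omega)
    obtain ⟨v, hv⟩ := hg0
    rw [← hv] at h
    simpa using TwoSidedIdeal.mul_mem_right _ _ (↑v⁻¹ : R) h

theorem coeff_mul_mem {f g : SkewPoly α}
    (hf : ∀ n, n ≠ 0 → coeff n f ∈ primeRadicalIdeal R)
    (hg : ∀ n, n ≠ 0 → coeff n g ∈ primeRadicalIdeal R) (n : ℕ) (hn : n ≠ 0) :
    coeff n (f * g) ∈ primeRadicalIdeal R := by
  rw [coeff_mul]
  refine sum_mem fun p hp => ?_
  rw [Finset.HasAntidiagonal.mem_antidiagonal] at hp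
  by_cases h1 : p.1 = 0
  · refine TwoSidedIdeal.mul_mem_left _ _ _ ?_
    rw [h1]
    exact hg _ (by omega)
  · exact TwoSidedIdeal.mul_mem_right _ _ _ (hf _ h1)

end SkewPoly

end TwoDeltaU

open TwoDeltaU SkewPoly in
theorem theorem3p29 {R : Type*} [Ring R] (α : R →+* R)
    (hprimal : TwoDeltaU.IsTwoPrimal R) (hα : TwoDeltaU.IsCompatible α) :
    TwoDeltaU.IsTwoDeltaU (TwoDeltaU.SkewPoly α) ↔ TwoDeltaU.IsTwoDeltaU R := by
  rw [isTwoDeltaU_iff, isTwoDeltaU_iff]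
  constructor
  · intro h u hu v hv
    have := isUnit_coeff_zero (h (C α u) (hu.map _) (C α v) (hv.map _))
    rwa [← map_pow, ← map_one (C α), ← map_sub, ← map_add, coeff_zero_C] at this
  · intro h f hf g hg
    have hf' := coeff_mem_of_isUnit hprimal hα hf
    refine isUnit_of_coeff hα ?_ fun n hn => ?_
    · have := h _ (isUnit_coeff_zero hf) _ (isUnit_coeff_zero hg)
      simpa [pow_two, coeff_zero_mul, coeff_one] using this
    · rw [map_add, map_sub, coeff_one, if_neg hn, sub_zero, pow_two]
      exact TwoSidedIdeal.add_mem _ (coeff_mul_mem hf' hf' n hn)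
        (coeff_mem_of_isUnit hprimal hα hg n hn)
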